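/- Let $G$ be a finite group, let $a_k$ be the largest degree of a complex irreducible character of $G$, and let $\chi_k$ be an irreducible character of $G$ of degree $a_k$. Put $N=\bigcap_{\psi\in\mathrm{Irr}(G),\,\psi\ne\chi_k}\ker\psi$, where $\mathrm{Irr}(G)$ is the set of complex irreducible characters of $G$. Call $G$ a CD1-group if $|G|>2$ and there are two columns of the character table of $G$ that differ in exactly one entry. A Frobenius group with complement $H$ and kernel $F$ is called doubly transitive if $|H|=|F|-1$. (Here a Frobenius group is a finite group with a subgroup $1<H<G$ such that $H\cap gHg^{-1}=1$ for all $g\notin H$, and $F$ consists of $1$ and the elements lying in no conjugate of $H$.) If $G$ is a CD1-group, then $|N|=p^n$ for some prime $p$ and some integer $n\ge 1$. Moreover, for every prime $p$ the following are equivalent: (i) $G$ is a CD1-group, $|N|=p^n$ for some integer $n\geq 1$, and $a_k<p$; (ii) $a_k=p-1$ and $G$ is a doubly transitive Frobenius group of order $(p-1)p$. -/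

import Mathlib

/-- `Irr(G)`: the set of complex irreducible characters of `G`, as functions on `G`. -/
def IrrChars (G : Type*) [Group G] : Set (G → ℂ) :=
  {χ | ∃ (V : Type) (_ : AddCommGroup V) (_ : Module ℂ V) (_ : FiniteDimensional ℂ V)
      (ρ : Representation ℂ G V), ρ.IsIrreducible ∧ χ = ρ.character}

/-- The set of degrees `χ(1)` of the irreducible characters of `G`. -/
def irrDegrees (G : Type*) [Group G] : Set ℕ :=
  {d | ∃ χ ∈ IrrChars G, χ 1 = (d : ℂ)}

/-- `G` is a CD1-group: `|G| > 2` and there are two columns of the character table (those of the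
classes of `a` and `b`) which differ in exactly one entry. -/
def IsCD1Group (G : Type*) [Group G] : Prop :=
  2 < Nat.card G ∧ ∃ a b : G, ∃! χ : G → ℂ, χ ∈ IrrChars G ∧ χ a ≠ χ b

/-- The kernel `{g | χ(g) = χ(1)}` of a character `χ`. -/
def charKer {G : Type*} [Group G] (χ : G → ℂ) : Set G :=
  {g | χ g = χ 1}

/-- The intersection of the kernels of all irreducible characters of `G` other than `χ`. -/
def kerOthers {G : Type*} [Group G] (χ : G → ℂ) : Set G :=
  ⋂ ψ ∈ IrrChars G \ {χ}, charKer ψ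

/-- `H` is a Frobenius complement in `G`: `1 < H < G` and `H ∩ gHg⁻¹ = 1` for all `g ∉ H`. -/
def IsFrobeniusComplement {G : Type*} [Group G] (H : Subgroup G) : Prop :=
  H ≠ ⊥ ∧ H ≠ ⊤ ∧ ∀ g : G, g ∉ H → ∀ x ∈ H, g * x * g⁻¹ ∈ H → x = 1

/-- The Frobenius kernel belonging to `H`: the identity together with the elements of `G` that
lie in no conjugate of `H`. -/
def frobeniusKernel {G : Type*} [Group G] (H : Subgroup G) : Set G :=
  {x | x = 1 ∨ ∀ g : G, g * x * g⁻¹ ∉ H}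

/-- `G` is a doubly transitive Frobenius group: a Frobenius group with complement `H` and kernel
`F` such that `|H| = |F| - 1`. -/
def IsDoublyTransitiveFrobenius (G : Type*) [Group G] : Prop :=
  ∃ H : Subgroup G, IsFrobeniusComplement H ∧ Nat.card H + 1 = (frobeniusKernel H).ncard

/-! Everything rests on column orthogonality. If columns `a` and `b` differ only in the row of `θ`,
comparing both with the column of `c` forces `θ c⁻¹ = 0` whenever `c` is conjugate to neither. Since
`θ 1 ≠ 0`, one of the two columns is that of `1` (`vanish_of_columns_agree`, `DiffersOnlyAt`). Then
`N = kerOthers θ` consists of `1` and the class of `b`, and `θ` vanishes off `N`. All nonidentity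
elements of `N` are conjugate, so they share a prime order and `|N|` is a prime power.

Write `q = |N|`, `d = θ 1`, and `M` for the sum of the squares of the other degrees. Orthogonality
gives `d + (q - 1) θ(b) = 0` and `M + d θ(b) = 0`, hence `M (q - 1) = d ^ 2`. So `d` exceeds every
other degree and `θ = χ`; integrality of `θ(b)` gives `q - 1 ∣ d`. If `d < p` and `q = p ^ n`, then
`q = p`, `d = p - 1`, `|G| = (p - 1) p`. Class size makes `N` contain the centralizers of its
nonidentity elements, and a Schur–Zassenhaus complement of `N` is the Frobenius complement.

Conversely, counting identifies the Frobenius kernel with a subgroup `N` of order `p`, whose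
nonidentity elements form one class, that of `b`. With `χ 1 = p - 1`, Cauchy–Schwarz applied to the
columns of `1` and `b` without the row of `χ` gives `χ(b) ^ 2 ≤ 1`. As `χ(b)` is an integer
congruent to `-1` modulo `p > 2`, it is `-1`; this is the equality case, so all other rows agree at
`1` and `b`. -/

open Representation Module

/-! ### Irreducible characters and the orthogonality relations. -/

section CharacterTheory

variable {G : Type*} [Group G]

theorem isIrreducible_iff_forall_submodule {V : Type*} [AddCommGroup V] [Module ℂ V]
    (ρ : Representation ℂ G V) :
    ρ.IsIrreducible ↔ Nontrivial V ∧
      ∀ p : Submodule ℂ V, (∀ g, ∀ v ∈ p, ρ g v ∈ p) → p = ⊥ ∨ p = ⊤ := by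
  constructor
  · intro h
    refine ⟨?_, fun p hp => ?_⟩
    · by_contra hV
      rw [not_nontrivial_iff_subsingleton] at hV
      apply bot_ne_top (α := Subrepresentation ρ)
      apply Subrepresentation.toSubmodule_injective
      exact Subsingleton.elim _ _
    · let q : Subrepresentation ρ := ⟨p, fun g v hv => hp g v hv⟩
      rcases h.eq_bot_or_eq_top q with h1 | h1
      · exact Or.inl (congrArg Subrepresentation.toSubmodule h1)
      · exact Or.inr (congrArg Subrepresentation.toSubmodule h1)
  · rintro ⟨hV, h⟩
    refine { exists_pair_ne := ⟨⊥, ⊤, fun h1 => ?_⟩, eq_bot_or_eq_top := fun q => ?_ }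
    · exact bot_ne_top (α := Submodule ℂ V) (congrArg Subrepresentation.toSubmodule h1)
    · rcases h q.toSubmodule (fun g v hv => q.apply_mem_toSubmodule g hv) with h1 | h1
      · exact Or.inl (Subrepresentation.toSubmodule_injective h1)
      · exact Or.inr (Subrepresentation.toSubmodule_injective h1)

/-- Transport to coordinates, since `IrrChars` only admits spaces in `Type`. -/
theorem character_mem_IrrChars {V : Type*} [AddCommGroup V] [Module ℂ V] [FiniteDimensional ℂ V]
    (ρ : Representation ℂ G V) (hρ : ρ.IsIrreducible) : ρ.character ∈ IrrChars G := by
  let e : V ≃ₗ[ℂ] (Fin (finrank ℂ V) → ℂ) := (finBasis ℂ V).equivFun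
  let σ : Representation ℂ G (Fin (finrank ℂ V) → ℂ) :=
    { toFun := fun g => e.conj (ρ g)
      map_one' := by simp [LinearEquiv.conj_id, Module.End.one_eq_id]
      map_mul' := fun g h => by
        rw [map_mul]; exact LinearEquiv.conj_comp e (ρ h) (ρ g) }
  refine ⟨_, inferInstance, inferInstance, inferInstance, σ, ?_, ?_⟩
  · rw [isIrreducible_iff_forall_submodule] at hρ ⊢
    obtain ⟨hV, h⟩ := hρ
    refine ⟨e.toEquiv.symm.nontrivial, fun p hp => ?_⟩
    have hcomap : ∀ g, ∀ v ∈ p.comap e.toLinearMap, ρ g v ∈ p.comap e.toLinearMap := by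
      intro g v hv
      have := hp g (e v) hv
      simpa [σ, LinearEquiv.conj_apply] using this
    rcases h (p.comap e.toLinearMap) hcomap with h1 | h1
    · left
      rw [eq_bot_iff]
      intro x hx
      have : e.symm x ∈ p.comap e.toLinearMap := by simpa using hx
      rw [h1] at this
      simpa using this
    · right
      rw [eq_top_iff]
      intro x _
      have : e.symm x ∈ p.comap e.toLinearMap := by rw [h1]; trivial
      simpa using this
  · funext g
    exact (LinearMap.trace_conj' (ρ g) e).symm

theorem one_mem_IrrChars : (1 : G → ℂ) ∈ IrrChars G := by
  refine ⟨ℂ, inferInstance, inferInstance, inferInstance, Representation.trivial ℂ G ℂ, ?_, ?_⟩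
  · rw [isIrreducible_iff_forall_submodule]
    exact ⟨inferInstance, fun p _ => eq_bot_or_eq_top p⟩
  · funext g
    simp [Representation.character, Representation.trivial]

theorem IrrChars_conj {ψ : G → ℂ} (hψ : ψ ∈ IrrChars G) (g h : G) : ψ (h * g * h⁻¹) = ψ g := by
  obtain ⟨V, _, _, _, ρ, _, rfl⟩ := hψ
  exact ρ.char_conj g h

theorem IrrChars_eq_of_isConj {ψ : G → ℂ} (hψ : ψ ∈ IrrChars G) {g h : G} (hgh : IsConj g h) :
    ψ g = ψ h := by
  obtain ⟨c, rfl⟩ := isConj_iff.1 hgh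
  rw [IrrChars_conj hψ]

theorem IrrChars_one {ψ : G → ℂ} (hψ : ψ ∈ IrrChars G) : ∃ d : ℕ, 0 < d ∧ ψ 1 = d := by
  obtain ⟨V, _, _, _, ρ, hρ, rfl⟩ := hψ
  have := ((isIrreducible_iff_forall_submodule ρ).1 hρ).1
  exact ⟨finrank ℂ V, finrank_pos, ρ.char_one⟩

variable [Fintype G]

theorem IrrChars_orthogonality {ψ φ : G → ℂ} (hψ : ψ ∈ IrrChars G) (hφ : φ ∈ IrrChars G) :
    ∑ g, ψ g * φ g⁻¹ = open Classical in if ψ = φ then (Nat.card G : ℂ) else 0 := by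
  have hG : (Nat.card G : ℂ) ≠ 0 := Nat.cast_ne_zero.2 Nat.card_pos.ne'
  let _ : Invertible (Nat.card G : ℂ) := invertibleOfNonzero hG
  split_ifs with h
  · subst h
    obtain ⟨V, _, _, _, ρ, hρ, rfl⟩ := hψ
    have := char_orthonormal ρ ρ
    rw [if_pos ⟨Representation.Equiv.refl ρ⟩] at this
    field_simp at this
    simpa using this
  · obtain ⟨V, _, _, _, ρ, hρ, rfl⟩ := hψ
    obtain ⟨W, _, _, _, σ, hσ, rfl⟩ := hφ
    have := char_orthonormal ρ σ
    rw [if_neg (fun ⟨e⟩ => h (char_iso e).symm)] at this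
    simpa [hG] using this

theorem IrrChars_linearIndependent :
    LinearIndependent ℂ (fun ψ : IrrChars G => (ψ : G → ℂ)) := by
  rw [linearIndependent_iff']
  intro s c hc φ hφ
  have h1 : ∑ g, (∑ ψ ∈ s, c ψ • (ψ : G → ℂ)) g * (φ : G → ℂ) g⁻¹ = 0 := by
    rw [hc]; simp
  simp only [Finset.sum_apply, Pi.smul_apply, smul_eq_mul, Finset.sum_mul] at h1
  rw [Finset.sum_comm] at h1
  simp only [mul_assoc, ← Finset.mul_sum] at h1
  rw [Finset.sum_eq_single φ, IrrChars_orthogonality φ.2 φ.2, if_pos rfl] at h1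
  · simpa using h1
  · intro ψ _ hne
    rw [IrrChars_orthogonality ψ.2 φ.2, if_neg (fun h => hne (Subtype.ext h)), mul_zero]
  · exact fun h => absurd hφ h

theorem IrrChars_finite : (IrrChars G).Finite :=
  Set.finite_coe_iff.1 (IrrChars_linearIndependent (G := G)).finite

/-- The operator `∑ f(g) ρ(g⁻¹)`. -/
noncomputable def classSum (f : G → ℂ) {V : Type*} [AddCommGroup V] [Module ℂ V]
    (ρ : Representation ℂ G V) : V →ₗ[ℂ] V := ∑ g, f g • ρ g⁻¹

theorem classSum_apply (f : G → ℂ) {V : Type*} [AddCommGroup V] [Module ℂ V]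
    (ρ : Representation ℂ G V) (v : V) : classSum f ρ v = ∑ g, f g • ρ g⁻¹ v := by
  simp [classSum, LinearMap.sum_apply]

theorem classSum_comm {f : G → ℂ} (hf : ∀ g h, f (h * g * h⁻¹) = f g) {V : Type*} [AddCommGroup V]
    [Module ℂ V] (ρ : Representation ℂ G V) (h : G) :
    classSum f ρ ∘ₗ ρ h = ρ h ∘ₗ classSum f ρ := by
  ext v
  simp only [LinearMap.comp_apply, classSum_apply, map_sum, map_smul]
  let e : G ≃ G := (MulEquiv.toEquiv (MulAut.conj h⁻¹ : G ≃* G))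
  refine Fintype.sum_equiv e (fun g => f g • ρ g⁻¹ (ρ h v)) (fun g => f g • ρ h (ρ g⁻¹ v))
    (fun g => ?_)
  have he : e g = h⁻¹ * g * h⁻¹⁻¹ := rfl
  simp only [he, hf, ← Module.End.mul_apply, ← map_mul]
  simp [mul_assoc]

/-- By Schur the operator is a scalar, and its trace is the vanishing pairing of `f` with the
character. -/
theorem classSum_eq_zero_of_irreducible {f : G → ℂ} (hf : ∀ g h, f (h * g * h⁻¹) = f g)
    (horth : ∀ ψ ∈ IrrChars G, ∑ g, f g * ψ g⁻¹ = 0) {V : Type*} [AddCommGroup V] [Module ℂ V]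
    [FiniteDimensional ℂ V] (ρ : Representation ℂ G V) (hρ : ρ.IsIrreducible) :
    classSum f ρ = 0 := by
  have := ((isIrreducible_iff_forall_submodule ρ).1 hρ).1
  let T : IntertwiningMap ρ ρ := ⟨classSum f ρ, classSum_comm hf ρ⟩
  obtain ⟨c, hc⟩ :=
    (IsIrreducible.algebraMap_intertwiningMap_bijective_of_isAlgClosed (ρ := ρ)).2 T
  have hT : classSum f ρ = c • LinearMap.id := by
    have := congrArg IntertwiningMap.toLinearMap hc
    exact this.symm
  have htr : LinearMap.trace ℂ V (classSum f ρ) = 0 := by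
    rw [classSum, map_sum, ← horth _ (character_mem_IrrChars ρ hρ)]
    simp [Representation.character]
  rw [hT, map_smul, LinearMap.trace_id, smul_eq_mul, mul_eq_zero] at htr
  have hc0 : c = 0 := htr.resolve_right (Nat.cast_ne_zero.2 finrank_pos.ne')
  rw [hT, hc0, zero_smul]

/-- Induction on dimension: by Maschke a reducible space is the sum of two proper
subrepresentations. -/
theorem classSum_eq_zero {f : G → ℂ} (hf : ∀ g h, f (h * g * h⁻¹) = f g)
    (horth : ∀ ψ ∈ IrrChars G, ∑ g, f g * ψ g⁻¹ = 0) (n : ℕ) {V : Type*} [AddCommGroup V]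
    [Module ℂ V] [FiniteDimensional ℂ V] (ρ : Representation ℂ G V) (hn : finrank ℂ V = n) :
    classSum f ρ = 0 := by
  induction n using Nat.strong_induction_on generalizing V with
  | _ n ih =>
    by_cases hV : Nontrivial V
    swap
    · rw [not_nontrivial_iff_subsingleton] at hV
      exact Subsingleton.elim _ _
    by_cases hρ : ρ.IsIrreducible
    · exact classSum_eq_zero_of_irreducible hf horth ρ hρ
    rw [isIrreducible_iff_forall_submodule] at hρ
    push Not at hρ
    obtain ⟨p, hp, hbot, htop⟩ := hρ hV
    have key : ∀ q : Subrepresentation ρ, q.toSubmodule ≠ ⊤ →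
        ∀ v ∈ q.toSubmodule, classSum f ρ v = 0 := by
      intro q hq v hv
      have h1 := ih _ (hn ▸ Submodule.finrank_lt hq) q.toRepresentation rfl
      have h2 := congrArg Subtype.val (LinearMap.congr_fun h1 ⟨v, hv⟩)
      rw [classSum_apply] at h2 ⊢
      simpa [Subrepresentation.toRepresentation] using h2
    have : NeZero (Nat.card G : ℂ) := ⟨Nat.cast_ne_zero.2 Nat.card_pos.ne'⟩
    have hss : IsSemisimpleRepresentation ρ := inferInstance
    let P : Subrepresentation ρ := ⟨p, fun g v hv => hp g v hv⟩
    obtain ⟨Q, hQ⟩ := hss.exists_isCompl P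
    have hQtop : Q.toSubmodule ≠ ⊤ := by
      intro h
      have hQ' : Q = ⊤ := Subrepresentation.toSubmodule_injective h
      rw [hQ'] at hQ
      have hP : P = ⊥ := by simpa using hQ.inf_eq_bot
      exact hbot (congrArg Subrepresentation.toSubmodule hP)
    have hsup : P.toSubmodule ⊔ Q.toSubmodule = ⊤ :=
      congrArg Subrepresentation.toSubmodule hQ.sup_eq_top
    ext v
    obtain ⟨x, hx, y, hy, rfl⟩ := Submodule.mem_sup.1 (hsup ▸ Submodule.mem_top (x := v))
    rw [map_add, key P htop x hx, key Q hQtop y hy]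
    simp

theorem classFunction_eq_zero {f : G → ℂ} (hf : ∀ g h, f (h * g * h⁻¹) = f g)
    (horth : ∀ ψ ∈ IrrChars G, ∑ g, f g * ψ g⁻¹ = 0) : f = 0 := by
  have h := classSum_eq_zero hf horth _ (leftRegular ℂ G) rfl
  have h1 := LinearMap.congr_fun h (MonoidAlgebra.single 1 1)
  rw [classSum_apply] at h1
  funext x
  -- The operator sends the basis vector at `1` to the sum of the `f g` times the basis vectors at
  -- `g⁻¹`, so the coefficient at `x⁻¹` is `f x`.
  have h2 := congrArg (fun y => MonoidAlgebra.coeff y x⁻¹) h1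
  simp only [ofMulAction_single, smul_eq_mul, mul_one, MonoidAlgebra.smul_single] at h2
  simp only [MonoidAlgebra.coeff_sum, Finset.sum_apply', MonoidAlgebra.coeff_single] at h2
  rw [Finset.sum_eq_single x (fun g _ hg => Finsupp.single_eq_of_ne (by simpa using hg.symm))
    (by simp)] at h2
  simpa using h2

/-- The irreducible characters as a finite set. -/
noncomputable def irrFinset (G : Type*) [Group G] [Fintype G] : Finset (G → ℂ) :=
  (IrrChars_finite (G := G)).toFinset

theorem mem_irrFinset {ψ : G → ℂ} : ψ ∈ irrFinset G ↔ ψ ∈ IrrChars G := by simp [irrFinset]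

/-- The difference of the two sides is a class function orthogonal to every irreducible character.
-/
theorem classFunction_expansion {f : G → ℂ} (hf : ∀ g h, f (h * g * h⁻¹) = f g) (a : G) :
    ∑ ψ ∈ irrFinset G, (∑ g, f g * ψ g⁻¹) * ψ a = Nat.card G * f a := by
  suffices h : (fun a => (Nat.card G * f a -
      ∑ ψ ∈ irrFinset G, (∑ g, f g * ψ g⁻¹) * ψ a : ℂ)) = 0 by
    exact (sub_eq_zero.1 (congrFun h a)).symm
  apply classFunction_eq_zero
  · intro g h
    rw [hf]
    congr 1
    refine Finset.sum_congr rfl fun ψ hψ => ?_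
    rw [IrrChars_conj (mem_irrFinset.1 hψ)]
  · intro φ hφ
    simp only [sub_mul, Finset.sum_sub_distrib, Finset.sum_mul]
    rw [Finset.sum_comm (s := Finset.univ) (t := irrFinset G),
      Finset.sum_eq_single φ, sub_eq_zero, Finset.sum_comm]
    · have h1 := IrrChars_orthogonality hφ hφ
      rw [if_pos rfl] at h1
      simp only [mul_assoc, ← Finset.mul_sum, h1]
      rw [Finset.mul_sum]
      exact Finset.sum_congr rfl fun x _ => by ring
    · intro ψ hψ hne
      have h1 := IrrChars_orthogonality (mem_irrFinset.1 hψ) hφ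
      rw [if_neg hne] at h1
      rw [Finset.sum_comm]
      simp only [mul_assoc, ← Finset.mul_sum, h1]
      simp
    · exact fun h => absurd (mem_irrFinset.2 hφ) h

open Classical in
-- Column orthogonality, obtained by expanding the indicator function of the class of `b`.
theorem sum_irr_mul_inv (a b : G) :
    (∑ ψ ∈ irrFinset G, ψ b⁻¹ * ψ a) * ({g | IsConj b g} : Finset G).card =
      if IsConj b a then (Nat.card G : ℂ) else 0 := by
  have h := classFunction_expansion (G := G) (f := fun g => if IsConj b g then 1 else 0)
    (fun g h => by
      have : IsConj g (h * g * h⁻¹) := isConj_iff.2 ⟨h, rfl⟩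
      simp only [show IsConj b (h * g * h⁻¹) ↔ IsConj b g from
        ⟨fun h1 => h1.trans this.symm, fun h1 => h1.trans this⟩]) a
  rw [mul_ite, mul_one, mul_zero] at h
  rw [← h, Finset.sum_mul]
  refine Finset.sum_congr rfl fun ψ hψ => ?_
  have h2 : ∑ g, (if IsConj b g then (1 : ℂ) else 0) * ψ g⁻¹ =
      ∑ g ∈ ({g | IsConj b g} : Finset G), ψ b⁻¹ := by
    rw [Finset.sum_filter]
    refine Finset.sum_congr rfl fun g _ => ?_
    split_ifs with h3
    · have : IsConj g⁻¹ b⁻¹ := by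
        obtain ⟨c, rfl⟩ := isConj_iff.1 h3
        exact (isConj_iff.2 ⟨c, by group⟩ : IsConj b⁻¹ _).symm
      rw [one_mul, IrrChars_eq_of_isConj (mem_irrFinset.1 hψ) this]
    · rw [zero_mul]
  rw [h2, Finset.sum_const, nsmul_eq_mul]
  ring

theorem isIntegral_IrrChars {ψ : G → ℂ} (hψ : ψ ∈ IrrChars G) (g : G) : IsIntegral ℤ (ψ g) := by
  obtain ⟨V, _, _, _, ρ, hρ, rfl⟩ := hψ
  rw [Representation.character,
    Module.End.trace_eq_sum_roots_charpoly_of_splits (IsAlgClosed.splits _)]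
  refine IsIntegral.multiset_sum fun μ hμ => ?_
  have hev : Module.End.HasEigenvalue (ρ g) μ := by
    rw [Module.End.hasEigenvalue_iff_isRoot_charpoly]
    exact (Polynomial.mem_roots'.1 hμ).2
  obtain ⟨v, hv⟩ := hev.exists_hasEigenvector
  have hpow : μ ^ Nat.card G = 1 := by
    have h1 := hv.pow_apply (Nat.card G)
    rw [← map_pow, pow_card_eq_one', map_one, Module.End.one_apply] at h1
    have h2 : (μ ^ Nat.card G - 1) • v = 0 := by rw [sub_smul, ← h1, one_smul, sub_self]
    exact sub_eq_zero.1 ((smul_eq_zero.1 h2).resolve_right hv.2)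
  refine ⟨Polynomial.X ^ Nat.card G - 1,
    Polynomial.monic_X_pow_sub_C 1 Nat.card_pos.ne', ?_⟩
  rw [Polynomial.eval₂_sub, Polynomial.eval₂_X_pow, hpow, Polynomial.eval₂_one, sub_self]

/-- The average of a character over `P` is the dimension of the `P`-invariants. -/
theorem sum_subgroup_IrrChars {ψ : G → ℂ} (hψ : ψ ∈ IrrChars G) (P : Subgroup G) [Fintype P] :
    ∃ m : ℕ, ∑ x : P, ψ x = Nat.card P * m := by
  obtain ⟨V, _, _, _, ρ, hρ, rfl⟩ := hψ
  have hP : (Nat.card P : ℂ) ≠ 0 := Nat.cast_ne_zero.2 Nat.card_pos.ne'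
  let _ : Invertible (Nat.card P : ℂ) := invertibleOfNonzero hP
  let σ : Representation ℂ P V := ρ.comp P.subtype
  refine ⟨finrank ℂ (invariants σ), ?_⟩
  rw [← card_inv_mul_sum_char_eq_finrank σ, mul_inv_cancel_left₀ hP]
  rfl

end CharacterTheory

/-! ### Kernels of characters are normal subgroups. -/

section KernelOfCharacter

variable {G : Type*} [Group G]

theorem eq_one_of_norm_eq_one_of_sum_re {s : Multiset ℂ} (hs : ∀ z ∈ s, ‖z‖ = 1)
    (hsum : s.sum = s.card) : ∀ z ∈ s, z = 1 := by
  have hre : (s.map fun z => 1 - z.re).sum = 0 := by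
    have h1 : (s.map Complex.re).sum = s.card := by
      have := congrArg Complex.re hsum
      rw [Complex.natCast_re] at this
      rw [← this]
      exact (map_multiset_sum Complex.reAddGroupHom s).symm
    rw [Multiset.sum_map_sub, h1]
    simp
  intro z hz
  have hnonneg : ∀ x ∈ s.map (fun z => 1 - z.re), (0 : ℝ) ≤ x := by
    intro x hx
    obtain ⟨w, hw, rfl⟩ := Multiset.mem_map.1 hx
    have := Complex.re_le_norm w
    rw [hs w hw] at this
    linarith
  have h2 := Multiset.single_le_sum hnonneg _ (Multiset.mem_map_of_mem _ hz)
  have h4 := hnonneg _ (Multiset.mem_map_of_mem _ hz)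
  have hzre : z.re = 1 := by linarith
  have hn := hs z hz
  rw [← Complex.re_add_im z, hzre]
  have h3 : z.re * z.re + z.im * z.im = 1 := by
    have := Complex.normSq_eq_norm_sq z
    rw [hn, Complex.normSq_apply] at this
    linarith
  have : z.im = 0 := by
    rw [hzre] at h3
    exact mul_self_eq_zero.1 (by linarith)
  simp [this]

/-- The eigenvalues are roots of unity summing to their number, so all are `1` and `f - 1` is
nilpotent. It is also semisimple, because `X ^ n - 1` is separable. -/
theorem End_eq_one_of_trace_eq_finrank {V : Type*} [AddCommGroup V] [Module ℂ V]
    [FiniteDimensional ℂ V] (f : Module.End ℂ V) {n : ℕ} (hn : n ≠ 0) (hf : f ^ n = 1)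
    (htr : LinearMap.trace ℂ V f = finrank ℂ V) : f = 1 := by
  have hroots : ∀ μ ∈ f.charpoly.roots, μ = 1 := by
    apply eq_one_of_norm_eq_one_of_sum_re
    · intro μ hμ
      have hev : Module.End.HasEigenvalue f μ := by
        rw [Module.End.hasEigenvalue_iff_isRoot_charpoly]
        exact (Polynomial.mem_roots'.1 hμ).2
      obtain ⟨v, hv⟩ := hev.exists_hasEigenvector
      have h1 := hv.pow_apply n
      rw [hf, Module.End.one_apply] at h1
      have h2 : (μ ^ n - 1) • v = 0 := by rw [sub_smul, ← h1, one_smul, sub_self]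
      have hpow := sub_eq_zero.1 ((smul_eq_zero.1 h2).resolve_right hv.2)
      exact Complex.norm_eq_one_of_pow_eq_one hpow hn
    · rw [← Module.End.trace_eq_sum_roots_charpoly_of_splits (IsAlgClosed.splits _), htr,
        ← (IsAlgClosed.splits f.charpoly).natDegree_eq_card_roots, LinearMap.charpoly_natDegree]
  have hrep : f.charpoly.roots = Multiset.replicate (finrank ℂ V) 1 := by
    rw [Multiset.eq_replicate]
    refine ⟨?_, hroots⟩
    rw [← (IsAlgClosed.splits f.charpoly).natDegree_eq_card_roots, LinearMap.charpoly_natDegree]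
  have hchar : f.charpoly = (Polynomial.X - Polynomial.C 1) ^ finrank ℂ V := by
    rw [(IsAlgClosed.splits f.charpoly).eq_prod_roots_of_monic f.charpoly_monic, hrep]
    simp
  have hnil : IsNilpotent (f - 1) := by
    refine ⟨finrank ℂ V, ?_⟩
    have := f.aeval_self_charpoly
    rw [hchar] at this
    simpa using this
  have hss : f.IsSemisimple := by
    refine Module.End.isSemisimple_of_squarefree_aeval_eq_zero
      (p := Polynomial.X ^ n - Polynomial.C 1) ?_ (by simp [hf])
    exact (Polynomial.separable_X_pow_sub_C (1 : ℂ) (Nat.cast_ne_zero.2 hn) one_ne_zero).squarefree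
  have hss1 : (f - algebraMap ℂ (Module.End ℂ V) 1).IsSemisimple :=
    Module.End.isSemisimple_sub_algebraMap_iff.2 hss
  rw [map_one] at hss1
  exact sub_eq_zero.1 (Module.End.eq_zero_of_isNilpotent_isSemisimple hnil hss1)

theorem exists_normal_eq_charKer [Finite G] {ψ : G → ℂ} (hψ : ψ ∈ IrrChars G) :
    ∃ K : Subgroup G, K.Normal ∧ (K : Set G) = charKer ψ := by
  obtain ⟨V, _, _, _, ρ, hρ, rfl⟩ := hψ
  refine ⟨MonoidHom.ker (ρ : G →* Module.End ℂ V), inferInstance, ?_⟩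
  ext g
  simp only [SetLike.mem_coe, MonoidHom.mem_ker, charKer, Set.mem_ofPred_eq]
  constructor
  · intro h
    change LinearMap.trace ℂ V (ρ g) = LinearMap.trace ℂ V (ρ 1)
    rw [map_one]
    exact congrArg _ h
  · intro h
    rw [Representation.char_one] at h
    exact End_eq_one_of_trace_eq_finrank (ρ g) (Nat.card_pos (α := G)).ne'
      (by rw [← map_pow, pow_card_eq_one', map_one]) h

theorem exists_normal_eq_kerOthers [Finite G] (χ : G → ℂ) :
    ∃ N : Subgroup G, N.Normal ∧ (N : Set G) = kerOthers χ := by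
  choose! K hK hK' using fun (ψ : G → ℂ) (hψ : ψ ∈ IrrChars G) => exists_normal_eq_charKer hψ
  refine ⟨⨅ ψ : (IrrChars G \ {χ} : Set (G → ℂ)), K ψ, ?_, ?_⟩
  · exact Subgroup.normal_iInf_normal fun ψ => hK ψ ψ.2.1
  · rw [Subgroup.coe_iInf, kerOthers, Set.biInter_eq_iInter]
    exact Set.iInter_congr fun ψ => hK' ψ ψ.2.1

theorem mem_kerOthers {χ : G → ℂ} {g : G} :
    g ∈ kerOthers χ ↔ ∀ ψ ∈ IrrChars G, ψ ≠ χ → ψ g = ψ 1 := by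
  simp [kerOthers, charKer]

end KernelOfCharacter

/-! ### Columns differing in one entry. -/

section Columns

variable {G : Type*} [Group G] [Fintype G]

theorem sum_irr_eq_zero_of_not_isConj {a b : G} (h : ¬ IsConj b a) :
    ∑ ψ ∈ irrFinset G, ψ b⁻¹ * ψ a = 0 := by
  classical
  have h1 := sum_irr_mul_inv a b
  rw [if_neg h] at h1
  refine (mul_eq_zero.1 h1).resolve_right (Nat.cast_ne_zero.2 ?_)
  exact Finset.card_ne_zero.2 ⟨b, Finset.mem_filter.2 ⟨Finset.mem_univ b, IsConj.refl b⟩⟩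

theorem sum_irr_self_mul_card {b : G} :
    (∑ ψ ∈ irrFinset G, ψ b⁻¹ * ψ b) * Nat.card {g // IsConj b g} = Nat.card G := by
  classical
  have h1 := sum_irr_mul_inv b b
  rw [if_pos (IsConj.refl b)] at h1
  rw [← h1, Nat.card_eq_fintype_card, Fintype.card_subtype]

theorem sum_irr_one_mul_one : ∑ ψ ∈ irrFinset G, ψ 1 * ψ 1 = Nat.card G := by
  have h := sum_irr_self_mul_card (b := (1 : G))
  have h1 : Nat.card {g : G // IsConj 1 g} = 1 := by
    simp only [isConj_one_right]
    simp
  rw [h1, inv_one] at h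
  simpa using h

theorem isConj_of_forall_irr {a b : G} (h : ∀ ψ ∈ IrrChars G, ψ a = ψ b) : IsConj b a := by
  by_contra hc
  have h1 := sum_irr_eq_zero_of_not_isConj hc
  have h2 := sum_irr_self_mul_card (b := b)
  rw [Finset.sum_congr rfl fun ψ hψ => by rw [h ψ (mem_irrFinset.1 hψ)]] at h1
  rw [h1, zero_mul] at h2
  exact Nat.cast_ne_zero.2 (Nat.card_pos (α := G)).ne' h2.symm

theorem sum_irr_eq_zero {ψ : G → ℂ} (hψ : ψ ∈ IrrChars G) (h1 : ψ ≠ 1) : ∑ g, ψ g = 0 := by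
  have := IrrChars_orthogonality hψ one_mem_IrrChars
  simpa [h1] using this

theorem vanish_of_columns_agree {θ : G → ℂ} (hθ : θ ∈ IrrChars G) {a b c : G}
    (hab : ∀ ψ ∈ IrrChars G, ψ ≠ θ → ψ a = ψ b) (hne : θ a ≠ θ b)
    (ha : ¬ IsConj c a) (hb : ¬ IsConj c b) : θ c⁻¹ = 0 := by
  have h := congrArg₂ (· - ·) (sum_irr_eq_zero_of_not_isConj ha) (sum_irr_eq_zero_of_not_isConj hb)
  simp only [← Finset.sum_sub_distrib, ← mul_sub, sub_zero] at h
  rw [Finset.sum_eq_single θ] at h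
  · exact (mul_eq_zero.1 h).resolve_right (sub_ne_zero.2 hne)
  · intro ψ hψ hψθ
    rw [hab ψ (mem_irrFinset.1 hψ) hψθ, sub_self, mul_zero]
  · exact fun h1 => absurd (mem_irrFinset.2 hθ) h1

/-- The columns of `1` and `b` differ exactly in the row of `θ`. -/
structure DiffersOnlyAt (θ : G → ℂ) (b : G) : Prop where
  mem : θ ∈ IrrChars G
  agree : ∀ ψ ∈ IrrChars G, ψ ≠ θ → ψ b = ψ 1
  differ : θ b ≠ θ 1

omit [Fintype G] in
theorem irr_one_ne_zero {θ : G → ℂ} (hθ : θ ∈ IrrChars G) : θ 1 ≠ 0 := by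
  obtain ⟨d, hd, h⟩ := IrrChars_one hθ
  rw [h]
  exact Nat.cast_ne_zero.2 hd.ne'

theorem IsCD1Group.exists_differsOnlyAt (h : IsCD1Group G) :
    ∃ (θ : G → ℂ) (b : G), DiffersOnlyAt θ b := by
  obtain ⟨_, a, b, θ, ⟨hθ, hne⟩, huniq⟩ := h
  have hagree : ∀ ψ ∈ IrrChars G, ψ ≠ θ → ψ a = ψ b := fun ψ hψ hψθ => by
    by_contra hc
    exact hψθ (huniq ψ ⟨hψ, hc⟩)
  by_cases ha : a = 1
  · subst ha
    exact ⟨θ, b, hθ, fun ψ h1 h2 => (hagree ψ h1 h2).symm, hne.symm⟩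
  by_cases hb : b = 1
  · subst hb
    exact ⟨θ, a, hθ, hagree, hne⟩
  exfalso
  -- If neither column were that of the identity, `θ 1` would vanish.
  have := vanish_of_columns_agree (c := 1) hθ hagree hne
    (fun hc => ha (isConj_one_right.1 hc))
    (fun hc => hb (isConj_one_right.1 hc))
  rw [inv_one] at this
  exact irr_one_ne_zero hθ this

namespace DiffersOnlyAt

variable {θ : G → ℂ} {b : G}

omit [Fintype G] in
theorem ne_one (h : DiffersOnlyAt θ b) : b ≠ 1 := fun hb => h.differ (by rw [hb])

omit [Fintype G] in
theorem theta_ne_one (h : DiffersOnlyAt θ b) : θ ≠ 1 := fun hθ => h.differ (by simp [hθ])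

theorem of_mem_kerOthers (h : DiffersOnlyAt θ b) {c : G} (hc : c ∈ kerOthers θ) (hc1 : c ≠ 1) :
    DiffersOnlyAt θ c := by
  refine ⟨h.mem, mem_kerOthers.1 hc, fun hθc => hc1 ?_⟩
  refine isConj_one_right.1 (isConj_of_forall_irr (a := c) (b := 1) fun ψ hψ => ?_)
  by_cases hψθ : ψ = θ
  · rw [hψθ, hθc]
  · exact mem_kerOthers.1 hc ψ hψ hψθ

theorem vanish (h : DiffersOnlyAt θ b) {c : G} (hc1 : c ≠ 1) (hc : ¬ IsConj c b) :
    θ c⁻¹ = 0 :=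
  vanish_of_columns_agree h.mem h.agree h.differ hc fun h1 => hc1 (isConj_one_left.1 h1)

/-- Otherwise the columns of `b` and `c` both differ from that of `1` only at `θ`. No element is
conjugate to both, so `θ` vanishes off `1`, contradicting orthogonality to the trivial character. -/
theorem isConj_of_mem (h : DiffersOnlyAt θ b) {c : G} (hc : c ∈ kerOthers θ) (hc1 : c ≠ 1) :
    IsConj b c := by
  by_contra hbc
  have h' := h.of_mem_kerOthers hc hc1
  have h0 : ∀ g : G, g ≠ 1 → θ g = 0 := by
    intro g hg
    rw [← inv_inv g]
    by_cases hgb : IsConj g⁻¹ b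
    · exact h'.vanish (inv_ne_one.2 hg) fun hgc => hbc (hgb.symm.trans hgc)
    · exact h.vanish (inv_ne_one.2 hg) hgb
  have hs := sum_irr_eq_zero h.mem h.theta_ne_one
  rw [Finset.sum_eq_single 1 (fun g _ hg => h0 g hg) (by simp)] at hs
  exact irr_one_ne_zero h.mem hs

theorem kerOthers_eq (h : DiffersOnlyAt θ b) : kerOthers θ = insert 1 {c | IsConj b c} := by
  ext c
  rw [Set.mem_insert_iff, Set.mem_ofPred_eq]
  constructor
  · intro hc
    by_cases hc1 : c = 1
    · exact Or.inl hc1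
    · exact Or.inr (h.isConj_of_mem hc hc1)
  · rintro (rfl | hc) <;> rw [mem_kerOthers]
    · exact fun _ _ _ => rfl
    · exact fun ψ hψ hψθ => by rw [← IrrChars_eq_of_isConj hψ hc, h.agree ψ hψ hψθ]

/-- Removes the inverse from `vanish` in `theta_eq_zero`. -/
theorem isConj_inv (h : DiffersOnlyAt θ b) : IsConj b b⁻¹ := by
  obtain ⟨N, _, hN'⟩ := exists_normal_eq_kerOthers θ
  refine h.isConj_of_mem ?_ (inv_ne_one.2 h.ne_one)
  have hb : b ∈ N := by
    rw [← SetLike.mem_coe, hN', h.kerOthers_eq]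
    exact Or.inr (IsConj.refl b)
  rw [← hN', SetLike.mem_coe]
  exact N.inv_mem hb

theorem theta_eq_zero (h : DiffersOnlyAt θ b) {g : G} (hg : g ∉ kerOthers θ) : θ g = 0 := by
  rw [h.kerOthers_eq, Set.mem_insert_iff, not_or, Set.mem_ofPred_eq] at hg
  rw [← inv_inv g]
  refine h.vanish (inv_ne_one.2 hg.1) fun hc => hg.2 ?_
  obtain ⟨c, hc⟩ := isConj_iff.1 (hc.trans h.isConj_inv)
  exact (isConj_iff.2 ⟨c, inv_injective (by rw [← hc]; group)⟩ : IsConj g b).symm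

theorem degree_add (h : DiffersOnlyAt θ b) :
    θ 1 + ((kerOthers θ).ncard - 1 : ℂ) * θ b = 0 := by
  classical
  have hs := sum_irr_eq_zero h.mem h.theta_ne_one
  have hsum : ∀ g, θ g = (if g = 1 then θ 1 - θ b else 0) + if g ∈ kerOthers θ then θ b else 0 := by
    intro g
    by_cases hg : g ∈ kerOthers θ
    · by_cases hg1 : g = 1
      · subst hg1
        simp [hg]
      · rw [if_neg hg1, if_pos hg, zero_add, IrrChars_eq_of_isConj h.mem (h.isConj_of_mem hg hg1)]
    · have h1 : g ≠ 1 := by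
        rintro rfl
        exact hg (mem_kerOthers.2 fun _ _ _ => rfl)
      rw [if_neg hg, if_neg h1, h.theta_eq_zero hg, add_zero]
  rw [Finset.sum_congr rfl fun g _ => hsum g, Finset.sum_add_distrib] at hs
  simp only [Finset.sum_ite_eq', Finset.mem_univ, if_true] at hs
  rw [← Finset.sum_filter, Finset.sum_const, nsmul_eq_mul] at hs
  have hcard : (kerOthers θ).ncard = (Finset.univ.filter (· ∈ kerOthers θ)).card := by
    rw [← Set.ncard_coe_finset]
    congr 1
    ext g
    simp
  rw [hcard]
  linear_combination hs

theorem sum_others (h : DiffersOnlyAt θ b) [DecidableEq (G → ℂ)] :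
    ∑ ψ ∈ (irrFinset G).erase θ, ψ 1 * ψ 1 + θ 1 * θ b = 0 := by
  have hc := sum_irr_eq_zero_of_not_isConj (a := b) (b := 1)
    (fun hc => h.ne_one (isConj_one_right.1 hc))
  rw [← Finset.sum_erase_add _ _ (mem_irrFinset.2 h.mem), inv_one] at hc
  rw [← hc]
  congr 1
  refine Finset.sum_congr rfl fun ψ hψ => ?_
  rw [Finset.mem_erase, mem_irrFinset] at hψ
  rw [h.agree ψ hψ.2 hψ.1]

end DiffersOnlyAt

end Columns

/-! ### Degrees, and the order of `N`. -/

section Degrees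

variable {G : Type*} [Group G]

/-- The degree of a character. -/
noncomputable def irrDeg (ψ : G → ℂ) : ℕ := ⌊(ψ 1).re⌋₊

theorem irrDeg_eq {ψ : G → ℂ} {d : ℕ} (h : ψ 1 = d) : irrDeg ψ = d := by
  rw [irrDeg, h, Complex.natCast_re, Nat.floor_natCast]

theorem irr_one_eq {ψ : G → ℂ} (hψ : ψ ∈ IrrChars G) : ψ 1 = irrDeg ψ := by
  obtain ⟨d, _, h⟩ := IrrChars_one hψ
  rw [irrDeg_eq h, h]

theorem irrDeg_pos {ψ : G → ℂ} (hψ : ψ ∈ IrrChars G) : 0 < irrDeg ψ := by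
  obtain ⟨d, hd, h⟩ := IrrChars_one hψ
  rwa [irrDeg_eq h]

variable [Fintype G]

theorem sum_irrDeg_sq [DecidableEq (G → ℂ)] {θ : G → ℂ} (hθ : θ ∈ IrrChars G) :
    ∑ ψ ∈ (irrFinset G).erase θ, irrDeg ψ ^ 2 + irrDeg θ ^ 2 = Nat.card G := by
  rw [Finset.sum_erase_add _ _ (mem_irrFinset.2 hθ)]
  have h := sum_irr_one_mul_one (G := G)
  rw [Finset.sum_congr rfl fun ψ hψ => by rw [irr_one_eq (mem_irrFinset.1 hψ)]] at h
  simp only [← sq] at h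
  exact_mod_cast h

namespace DiffersOnlyAt

variable {θ : G → ℂ} {b : G}

theorem two_le_ncard (h : DiffersOnlyAt θ b) : 2 ≤ (kerOthers θ).ncard := by
  have h1 : ({1, b} : Set G) ⊆ kerOthers θ := by
    rw [h.kerOthers_eq]
    rintro x (rfl | rfl)
    · exact Or.inl rfl
    · exact Or.inr (IsConj.refl _)
  calc 2 = ({1, b} : Set G).ncard := (Set.ncard_pair h.ne_one.symm).symm
    _ ≤ _ := Set.ncard_le_ncard h1 (Set.toFinite _)

theorem sum_others_mul [DecidableEq (G → ℂ)] (h : DiffersOnlyAt θ b) :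
    (∑ ψ ∈ (irrFinset G).erase θ, irrDeg ψ ^ 2) * ((kerOthers θ).ncard - 1) = irrDeg θ ^ 2 := by
  have h1 := h.degree_add
  have h2 := h.sum_others
  rw [Finset.sum_congr rfl fun ψ hψ => by
    rw [irr_one_eq (mem_irrFinset.1 (Finset.mem_of_mem_erase hψ))]] at h2
  have h3 : ((∑ ψ ∈ (irrFinset G).erase θ, irrDeg ψ ^ 2 : ℕ) : ℂ) =
      ∑ ψ ∈ (irrFinset G).erase θ, (irrDeg ψ : ℂ) * irrDeg ψ := by
    push_cast
    simp only [sq]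
  rw [← h3, irr_one_eq h.mem] at h2
  rw [irr_one_eq h.mem] at h1
  have hq := h.two_le_ncard
  have : ((∑ ψ ∈ (irrFinset G).erase θ, irrDeg ψ ^ 2 : ℕ) : ℂ) *
      (((kerOthers θ).ncard - 1 : ℕ) : ℂ) = ((irrDeg θ : ℕ) : ℂ) ^ 2 := by
    rw [Nat.cast_sub (by omega), Nat.cast_one]
    linear_combination ((kerOthers θ).ncard - 1 : ℂ) * h2 - (irrDeg θ : ℂ) * h1
  exact_mod_cast this

theorem irrDeg_lt (h : DiffersOnlyAt θ b) (hG : 2 < Nat.card G) {ψ : G → ℂ}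
    (hψ : ψ ∈ IrrChars G) (hne : ψ ≠ θ) : irrDeg ψ < irrDeg θ := by
  classical
  by_contra! hle
  have h1 := sum_irrDeg_sq h.mem
  have h2 := h.sum_others_mul
  have hq := h.two_le_ncard
  have hM : ∑ ψ ∈ (irrFinset G).erase θ, irrDeg ψ ^ 2 ≤ irrDeg θ ^ 2 := by
    rw [← h2]
    exact Nat.le_mul_of_pos_right _ (by omega)
  have hψm : ψ ∈ (irrFinset G).erase θ := Finset.mem_erase.2 ⟨hne, mem_irrFinset.2 hψ⟩
  have h1m : (1 : G → ℂ) ∈ (irrFinset G).erase θ :=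
    Finset.mem_erase.2 ⟨h.theta_ne_one.symm, mem_irrFinset.2 one_mem_IrrChars⟩
  have hdeg1 : irrDeg (1 : G → ℂ) = 1 := irrDeg_eq (by simp)
  have hsq : irrDeg θ ^ 2 ≤ irrDeg ψ ^ 2 := Nat.pow_le_pow_left hle 2
  by_cases hψ1 : ψ = 1
  · subst hψ1
    rw [hdeg1] at hsq
    omega
  -- The rows `ψ` and `1` already contribute `irrDeg ψ ^ 2 + 1`, more than the bound `irrDeg θ ^ 2`
  -- allows.
  · have h3 : ∑ φ ∈ {ψ, 1}, irrDeg φ ^ 2 ≤ ∑ φ ∈ (irrFinset G).erase θ, irrDeg φ ^ 2 :=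
      Finset.sum_le_sum_of_subset (by
        intro x hx
        rcases Finset.mem_insert.1 hx with rfl | hx
        · exact hψm
        · rw [Finset.mem_singleton.1 hx]; exact h1m)
    rw [Finset.sum_pair hψ1, hdeg1] at h3
    omega

theorem eq_of_isGreatest (h : DiffersOnlyAt θ b) (hG : 2 < Nat.card G) {χ : G → ℂ} {a : ℕ}
    (hχ : χ ∈ IrrChars G) (hχa : χ 1 = (a : ℂ)) (ha : IsGreatest (irrDegrees G) a) : χ = θ := by
  by_contra hne
  have h1 := h.irrDeg_lt hG hχ hne
  rw [irrDeg_eq hχa] at h1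
  have := ha.2 ⟨θ, h.mem, irr_one_eq h.mem⟩
  omega

/-- Every nonidentity element of `N` is conjugate to one of prime order `p`, so `N` is a `p`-group.
-/
theorem exists_prime_pow (h : DiffersOnlyAt θ b) :
    ∃ p n : ℕ, p.Prime ∧ 0 < n ∧ (kerOthers θ).ncard = p ^ n := by
  obtain ⟨N, _, hN⟩ := exists_normal_eq_kerOthers θ
  have hcard : (kerOthers θ).ncard = Nat.card N := by
    rw [← hN]
    rfl
  have hq := h.two_le_ncard
  rw [hcard] at hq ⊢
  have hp : (Nat.card N).minFac.Prime := Nat.minFac_prime (by omega)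
  set p := (Nat.card N).minFac with hpdef
  have : Fact p.Prime := ⟨hp⟩
  obtain ⟨x, hx⟩ := exists_prime_orderOf_dvd_card' (G := N) p (Nat.minFac_dvd _)
  have hmem : ∀ y : N, (y : G) ∈ kerOthers θ := fun y => hN ▸ y.2
  have hx1 : (x : G) ≠ 1 := by
    intro hx1
    rw [OneMemClass.coe_eq_one] at hx1
    rw [hx1, orderOf_one] at hx
    exact hp.one_lt.ne hx
  have hpg : IsPGroup p N := by
    intro y
    refine ⟨1, ?_⟩
    by_cases hy : (y : G) = 1
    · rw [OneMemClass.coe_eq_one] at hy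
      rw [hy, one_pow]
    · obtain ⟨c, hc⟩ := isConj_iff.1
        ((h.of_mem_kerOthers (hmem x) hx1).isConj_of_mem (hmem y) hy)
      have hxp : (x : G) ^ p = 1 := by
        rw [← hx, ← Subgroup.coe_pow, pow_orderOf_eq_one, Subgroup.coe_one]
      rw [pow_one, ← OneMemClass.coe_eq_one, Subgroup.coe_pow, ← hc, conj_pow, hxp]
      group
  obtain ⟨n, hn⟩ := IsPGroup.iff_card.1 hpg
  refine ⟨p, n, hp, Nat.pos_of_ne_zero ?_, hn⟩
  rintro rfl
  rw [pow_zero] at hn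
  omega

end DiffersOnlyAt

theorem int_of_isIntegral_of_mul_eq {x : ℂ} (hx : IsIntegral ℤ x) {k m : ℤ} (hk : k ≠ 0)
    (h : x * k = m) : ∃ z : ℤ, x = z := by
  have hxq : x = algebraMap ℚ ℂ ((m : ℚ) / k) := by
    have : (k : ℂ) ≠ 0 := Int.cast_ne_zero.2 hk
    rw [eq_ratCast]
    push_cast
    rw [← h]
    field_simp
  rw [hxq] at hx
  have h1 : IsIntegral ℤ ((m : ℚ) / k) :=
    (isIntegral_algebraMap_iff (algebraMap ℚ ℂ).injective).1 hx
  obtain ⟨z, hz⟩ := IsIntegrallyClosed.isIntegral_iff.1 h1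
  refine ⟨z, ?_⟩
  rw [hxq, ← hz]
  simp

/-- By `degree_add`, `θ b` is rational; being an algebraic integer, it is an integer. -/
theorem DiffersOnlyAt.ncard_sub_one_dvd {θ : G → ℂ} {b : G} (h : DiffersOnlyAt θ b) :
    (kerOthers θ).ncard - 1 ∣ irrDeg θ := by
  have hq := h.two_le_ncard
  have h1 := h.degree_add
  rw [irr_one_eq h.mem] at h1
  have hcast : (((kerOthers θ).ncard - 1 : ℕ) : ℂ) = (kerOthers θ).ncard - 1 := by
    rw [Nat.cast_sub (by omega), Nat.cast_one]
  rw [← hcast] at h1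
  obtain ⟨z, hz⟩ := int_of_isIntegral_of_mul_eq (isIntegral_IrrChars h.mem b)
    (k := (((kerOthers θ).ncard - 1 : ℕ) : ℤ)) (m := -(irrDeg θ : ℤ))
    (by omega) (by push_cast [-Nat.cast_sub]; linear_combination h1)
  rw [hz] at h1
  have h2 : (irrDeg θ : ℤ) + (((kerOthers θ).ncard - 1 : ℕ) : ℤ) * z = 0 := by exact_mod_cast h1
  rw [← Int.natCast_dvd_natCast]
  exact ⟨-z, by linear_combination h2⟩

end Degrees

/-! ### Class sizes and centralizers. -/

section ClassSize

variable {G : Type*} [Group G]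

theorem card_isConj_mul_card_centralizer (b : G) :
    Nat.card {c // IsConj b c} * Nat.card (Subgroup.centralizer {b}) = Nat.card G := by
  have h1 : MulAction.orbit (ConjAct G) b = {c | IsConj b c} := by
    ext c
    rw [ConjAct.mem_orbit_conjAct, Set.mem_ofPred_eq, isConj_comm]
  have h2 := MulAction.index_stabilizer (ConjAct G) b
  rw [h1] at h2
  rw [Subgroup.nat_card_centralizer_nat_card_stabilizer]
  change Set.ncard {c | IsConj b c} * _ = _
  rw [← h2, Subgroup.index_mul_card]
  rfl

end ClassSize

/-! ### Frobenius groups of order `(p - 1) p`. -/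

section FrobeniusGroups

variable {G : Type*} [Group G] [Finite G]

theorem mem_of_commute_of_forall_isConj {N : Subgroup G} {p : ℕ} (hp : p.Prime)
    (hN : Nat.card N = p) (hG : Nat.card G = (p - 1) * p) {b : G} (hb : b ∈ N)
    (hclass : ∀ c, IsConj b c ↔ c ∈ N ∧ c ≠ 1) {x : G} (hx : x * b = b * x) : x ∈ N := by
  have : Fact p.Prime := ⟨hp⟩
  have hcard : Nat.card {c // IsConj b c} = p - 1 := by
    have h1 : {c | IsConj b c} = (N : Set G) \ {1} := by
      ext c
      simpa using hclass c
    change Set.ncard {c | IsConj b c} = _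
    rw [h1, Set.ncard_sdiff_singleton_of_mem N.one_mem, ← hN]
    rfl
  have h2 := card_isConj_mul_card_centralizer b
  rw [hcard, hG] at h2
  have h3 : Nat.card (Subgroup.centralizer {b}) = p :=
    Nat.eq_of_mul_eq_mul_left (by have := hp.two_le; omega) h2
  have hle : N ≤ Subgroup.centralizer {b} := by
    have : IsCyclic N := isCyclic_of_prime_card hN
    intro y hy
    rw [Subgroup.mem_centralizer_singleton_iff]
    have := (IsCyclic.isMulCommutative (α := N)).is_comm.comm ⟨y, hy⟩ ⟨b, hb⟩
    exact congrArg Subtype.val this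
  rw [Subgroup.eq_of_le_of_card_ge hle (by rw [h3, hN]), Subgroup.mem_centralizer_singleton_iff]
  exact hx

theorem isDoublyTransitiveFrobenius_of_normal {N : Subgroup G} [N.Normal] {p : ℕ} (hp : p.Prime)
    (hp2 : 2 < p) (hN : Nat.card N = p) (hG : Nat.card G = (p - 1) * p)
    (hcent : ∀ n ∈ N, n ≠ 1 → ∀ x : G, x * n = n * x → x ∈ N) :
    IsDoublyTransitiveFrobenius G := by
  have hindex : N.index = p - 1 := by
    have := N.card_mul_index
    rw [hN, hG, mul_comm] at this
    exact Nat.eq_of_mul_eq_mul_right hp.pos this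
  obtain ⟨H, hH⟩ := Subgroup.exists_right_complement'_of_coprime (N := N) (by
    rw [hindex, hN]
    exact (Nat.coprime_self_sub_right hp.one_le).2 (Nat.coprime_one_right p))
  have hHcard : Nat.card H = p - 1 := by rw [← hindex, hH.symm.index_eq_card]
  have hdisj : ∀ x, x ∈ N → x ∈ H → x = 1 := fun x h1 h2 => by
    have := hH.disjoint
    rw [Subgroup.disjoint_def] at this
    exact this h1 h2
  have hfac : ∀ g : G, ∃ n ∈ N, ∃ h ∈ H, n * h = g := fun g => by
    obtain ⟨⟨n, h⟩, hnh⟩ := hH.2 g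
    exact ⟨n, n.2, h, h.2, hnh⟩
  have hker : frobeniusKernel H = N := by
    ext x
    rw [SetLike.mem_coe]
    constructor
    · rintro (rfl | hx)
      · exact N.one_mem
      by_contra hxN
      -- For `x ∉ N` no nonidentity element of `N` commutes with `x`, so this map is injective,
      -- hence onto. The `N`-conjugates of `x` thus fill the coset `N x`, which meets `H`.
      let φ : N → N := fun n => ⟨n * x * n⁻¹ * x⁻¹, by
        have h1 : x * (n : G)⁻¹ * x⁻¹ ∈ N := ‹N.Normal›.conj_mem _ (N.inv_mem n.2) x
        simpa [mul_assoc] using N.mul_mem n.2 h1⟩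
      have hφ : Function.Injective φ := by
        intro m n hmn
        have h1 : (m : G) * x * (m : G)⁻¹ * x⁻¹ = n * x * (n : G)⁻¹ * x⁻¹ :=
          congrArg Subtype.val hmn
        by_contra hne
        apply hxN
        apply hcent ((n : G)⁻¹ * m) (N.mul_mem (N.inv_mem n.2) m.2)
        · intro h2
          exact hne (Subtype.ext (inv_mul_eq_one.1 h2).symm)
        · have h2 := mul_right_cancel h1
          calc x * ((n : G)⁻¹ * m) = (n : G)⁻¹ * (n * x * (n : G)⁻¹) * m := by group
            _ = (n : G)⁻¹ * (m * x * (m : G)⁻¹) * m := by rw [h2]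
            _ = _ := by group
      obtain ⟨m, hm, h, hh, hmh⟩ := hfac x
      obtain ⟨n, hn⟩ := Finite.surjective_of_injective hφ ⟨m⁻¹, N.inv_mem hm⟩
      have hn' : (n : G) * x * (n : G)⁻¹ * x⁻¹ = m⁻¹ := congrArg Subtype.val hn
      apply hx n
      have : (n : G) * x * (n : G)⁻¹ = h := by
        rw [mul_inv_eq_iff_eq_mul] at hn'
        rw [hn', ← hmh]
        group
      rw [this]
      exact hh
    · intro hx
      by_cases hx1 : x = 1
      · exact Or.inl hx1
      · right
        intro g hg
        have := hdisj _ (‹N.Normal›.conj_mem x hx g) hg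
        exact hx1 (by simpa using this)
  refine ⟨H, ⟨?_, ?_, ?_⟩, ?_⟩
  · rintro rfl
    rw [Subgroup.card_bot] at hHcard
    omega
  · rintro rfl
    rw [Subgroup.card_top, hG] at hHcard
    have : (p - 1) * 2 ≤ (p - 1) * p := Nat.mul_le_mul_left _ (by omega)
    omega
  · intro g hg x hx hgx
    obtain ⟨n, hn, h, hh, rfl⟩ := hfac g
    have hn1 : n ≠ 1 := by
      rintro rfl
      exact hg (by simpa using hh)
    set y := h * x * h⁻¹ with hy
    have hyH : y ∈ H := H.mul_mem (H.mul_mem hh hx) (H.inv_mem hh)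
    have hny : n * y * n⁻¹ ∈ H := by
      convert! hgx using 1
      rw [hy]
      group
    -- The commutator lies in `N` by normality and in `H` by assumption.
    have h1 : n * y * n⁻¹ * y⁻¹ = 1 := by
      apply hdisj
      · have h1 : y * n⁻¹ * y⁻¹ ∈ N := ‹N.Normal›.conj_mem _ (N.inv_mem hn) y
        simpa [mul_assoc] using N.mul_mem hn h1
      · exact H.mul_mem hny (H.inv_mem hyH)
    have h2 : y * n = n * y := by
      rw [mul_inv_eq_one, mul_inv_eq_iff_eq_mul] at h1
      exact h1.symm
    have h3 := hdisj y (hcent n hn hn1 y h2) hyH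
    rw [hy] at h3
    simpa using h3
  · rw [hker, hHcard]
    have : (N : Set G).ncard = p := hN
    omega

/-- Double counting: `(g, h) ↦ g * h * g⁻¹`, for `h ≠ 1` in `H`, maps onto the complement of the
kernel, and each fibre has `|H|` elements. This does not need the kernel to be a subgroup. -/
theorem IsFrobeniusComplement.card_mul_ncard {H : Subgroup G} (hH : IsFrobeniusComplement H) :
    Nat.card H * (frobeniusKernel H).ncard = Nat.card G := by
  classical
  obtain ⟨_, _, hH⟩ := hH
  have := Fintype.ofFinite G
  let S : Finset (G × G) := Finset.univ ×ˢ Finset.univ.filter fun x => x ∈ H ∧ x ≠ 1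
  let T : Finset G := Finset.univ.filter fun x => x ∉ frobeniusKernel H
  have hmem : ∀ x, x ∈ T ↔ x ≠ 1 ∧ ∃ g, g * x * g⁻¹ ∈ H := by
    intro x
    simp [T, frobeniusKernel]
  have hHcard : (Finset.univ.filter fun x => x ∈ H).card = Nat.card H := by
    rw [Nat.card_eq_fintype_card, Fintype.card_subtype]
  have hS : S.card = Nat.card G * (Nat.card H - 1) := by
    rw [Finset.card_product, Finset.card_univ, Nat.card_eq_fintype_card (α := G), ← hHcard]
    congr 1
    rw [← Finset.card_erase_of_mem (by simp [H.one_mem] : (1 : G) ∈ _)]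
    congr 1
    ext x
    simp [and_comm]
  have hT : T.card + (frobeniusKernel H).ncard = Nat.card G := by
    have h1 : (frobeniusKernel H).ncard = (Finset.univ.filter (· ∈ frobeniusKernel H)).card := by
      rw [← Set.ncard_coe_finset]
      congr 1
      ext g
      simp
    rw [h1, add_comm, Nat.card_eq_fintype_card, ← Finset.card_univ]
    exact Finset.card_filter_add_card_filter_not _
  have hST : S.card = T.card * Nat.card H := by
    have hmaps : ∀ z ∈ S, z.1 * z.2 * z.1⁻¹ ∈ T := by
      rintro ⟨g, h⟩ hz
      have hz' : h ∈ H ∧ h ≠ 1 := by simpa [S] using hz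
      rw [hmem]
      refine ⟨fun h1 => hz'.2 (by simpa using h1), g⁻¹, ?_⟩
      simpa [mul_assoc] using hz'.1
    rw [Finset.card_eq_sum_card_fiberwise hmaps, Finset.sum_const_nat (m := Nat.card H)]
    intro x hx
    obtain ⟨hx1, g, hg⟩ := (hmem x).1 hx
    rw [← hHcard]
    symm
    refine Finset.card_bij (fun k _ => (g⁻¹ * k, k⁻¹ * (g * x * g⁻¹) * k)) ?_ ?_ ?_
    · intro k hk
      have hk' : k ∈ H := by simpa using hk
      simp only [S, Finset.mem_filter, Finset.mem_product, Finset.mem_univ, true_and]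
      refine ⟨⟨H.mul_mem (H.mul_mem (H.inv_mem hk') hg) hk', fun h1 => hx1 ?_⟩, by group⟩
      have h2 : x = g⁻¹ * k * (k⁻¹ * (g * x * g⁻¹) * k) * (g⁻¹ * k)⁻¹ := by group
      rw [h2, h1]
      group
    · intro k _ l _ hkl
      exact mul_left_cancel (Prod.ext_iff.1 hkl).1
    · rintro ⟨u, h⟩ hz
      simp only [S, Finset.mem_filter, Finset.mem_product, Finset.mem_univ, true_and] at hz
      obtain ⟨⟨hh, hh1⟩, rfl⟩ := hz
      refine ⟨g * u, ?_, ?_⟩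
      · simp only [Finset.mem_filter, Finset.mem_univ, true_and]
        by_contra hgu
        refine hh1 (hH _ hgu h hh ?_)
        convert! hg using 1
        group
      · rw [Prod.mk.injEq]
        constructor <;> group
  have hH1 : 0 < Nat.card H := Nat.card_pos
  rw [hST] at hS
  obtain ⟨k, hk⟩ : ∃ k, Nat.card H = k + 1 := ⟨Nat.card H - 1, by omega⟩
  rw [hk, Nat.add_sub_cancel] at hS
  rw [hk]
  rw [← hT] at hS ⊢
  nlinarith

theorem IsDoublyTransitiveFrobenius.exists_normal (h : IsDoublyTransitiveFrobenius G) {p : ℕ}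
    (hp : p.Prime) (hG : Nat.card G = (p - 1) * p) :
    2 < p ∧ ∃ N : Subgroup G, Nat.card N = p ∧
      ∀ b ∈ N, b ≠ 1 → (∀ c, IsConj b c ↔ c ∈ N ∧ c ≠ 1) := by
  obtain ⟨H, hF, hdt⟩ := h
  have hmul := hF.card_mul_ncard
  obtain ⟨hbot, _, hH⟩ := hF
  obtain ⟨k, rfl⟩ : ∃ k, p = k + 1 := ⟨p - 1, by have := hp.pos; omega⟩
  rw [← hdt, hG, Nat.add_sub_cancel] at hmul
  have hHk : Nat.card H = k := by
    rcases lt_trichotomy (Nat.card H) k with h1 | h1 | h1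
    · nlinarith
    · exact h1
    · nlinarith
  have hHne : Nat.card H ≠ 1 := fun h1 => hbot (Subgroup.card_eq_one.1 h1)
  have hk2 : 2 ≤ k := by have := hp.two_le; omega
  refine ⟨by omega, ?_⟩
  have : Fact (k + 1).Prime := ⟨hp⟩
  obtain ⟨x, hx⟩ := exists_prime_orderOf_dvd_card' (G := G) (k + 1) (by
    rw [hG]; exact Dvd.intro_left _ rfl)
  have hcardN : Nat.card (Subgroup.zpowers x) = k + 1 := by rw [Nat.card_zpowers, hx]
  -- Nonidentity powers of `x` have order `k + 1`, which does not divide `|H| = k`, so they avoid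
  -- all conjugates of `H`; the cardinalities agree.
  have hker : (Subgroup.zpowers x : Set G) = frobeniusKernel H := by
    apply Set.eq_of_subset_of_ncard_le
    · intro y hy
      by_cases hy1 : y = 1
      · exact Or.inl hy1
      right
      intro g hg
      have hy' : orderOf y = k + 1 := by
        have h1 : orderOf y ∣ k + 1 := hx ▸ orderOf_dvd_of_mem_zpowers hy
        rcases (Nat.dvd_prime hp).1 h1 with h2 | h2
        · exact absurd (orderOf_eq_one_iff.1 h2) hy1
        · exact h2
      have h3 : orderOf (g * y * g⁻¹) ∣ k := hHk ▸ Subgroup.orderOf_dvd_natCard H hg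
      have h4 : orderOf (g * y * g⁻¹) = orderOf y := by
        have := orderOf_injective (MulAut.conj g : G ≃* G).toMonoidHom
          (MulAut.conj g : G ≃* G).injective y
        simpa using this
      rw [h4, hy'] at h3
      have := Nat.le_of_dvd (by omega) h3
      omega
    · rw [← hdt, hHk]
      exact hcardN.ge
    · exact Set.toFinite _
  have hnormal : ∀ g y : G, y ∈ Subgroup.zpowers x → g * y * g⁻¹ ∈ Subgroup.zpowers x := by
    intro g y hy
    rw [← SetLike.mem_coe, hker] at hy ⊢
    rcases hy with rfl | hy
    · left; group
    · right
      intro u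
      have := hy (u * g)
      convert! this using 2
      group
  refine ⟨Subgroup.zpowers x, hcardN, fun b hb hb1 => ?_⟩
  -- A nonidentity `c` outside the kernel has a conjugate in `H`. If `c` commutes with `b`, the
  -- complement condition puts the corresponding conjugate of `b` in `H` too.
  have hcent : Subgroup.centralizer {b} ≤ Subgroup.zpowers x := by
    intro c hc
    rw [Subgroup.mem_centralizer_singleton_iff] at hc
    by_contra hcN
    rw [← SetLike.mem_coe, hker] at hcN hb
    simp only [frobeniusKernel, Set.mem_ofPred_eq, not_or, not_forall, not_not] at hcN hb
    obtain ⟨hc1, g, hg⟩ := hcN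
    refine (hb.resolve_left hb1) g ?_
    by_contra hbH
    have := hH _ hbH _ hg (by
      convert! hg using 1
      calc g * b * g⁻¹ * (g * c * g⁻¹) * (g * b * g⁻¹)⁻¹ = g * (b * c) * b⁻¹ * g⁻¹ := by group
        _ = g * (c * b) * b⁻¹ * g⁻¹ := by rw [hc]
        _ = _ := by group)
    exact hc1 (by simpa using this)
  have hsub : {c | IsConj b c} ⊆ (Subgroup.zpowers x : Set G) \ {1} := by
    intro c hc
    obtain ⟨g, rfl⟩ := isConj_iff.1 hc
    exact ⟨hnormal g b hb, fun h1 => hb1 (by simpa using h1)⟩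
  have hcardle : Nat.card (Subgroup.centralizer {b}) ≤ k + 1 := by
    rw [← hcardN]
    exact Subgroup.card_le_of_le hcent
  have heq : {c | IsConj b c} = (Subgroup.zpowers x : Set G) \ {1} := by
    apply Set.eq_of_subset_of_ncard_le hsub
    · rw [Set.ncard_sdiff_singleton_of_mem (Subgroup.one_mem _)]
      have h1 := card_isConj_mul_card_centralizer b
      rw [hG, Nat.add_sub_cancel] at h1
      have h2 : (Subgroup.zpowers x : Set G).ncard = k + 1 := hcardN
      rw [h2, Nat.add_sub_cancel]
      change k ≤ Nat.card {c // IsConj b c}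
      by_contra! hlt
      have := Nat.mul_le_mul hlt.le hcardle
      have := Nat.mul_lt_mul_of_lt_of_le hlt hcardle (by omega)
      omega
  intro c
  have := Set.ext_iff.1 heq c
  simpa using this

end FrobeniusGroups

/-! ### The two implications. -/

section MainTheorem

variable {G : Type*} [Group G] [Fintype G]

theorem DiffersOnlyAt.isDoublyTransitiveFrobenius {θ : G → ℂ} {b : G} (h : DiffersOnlyAt θ b)
    (hG : 2 < Nat.card G) {p n : ℕ} (hp : p.Prime) (hn : 0 < n)
    (hN : (kerOthers θ).ncard = p ^ n) (hlt : irrDeg θ < p) :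
    irrDeg θ = p - 1 ∧ IsDoublyTransitiveFrobenius G ∧ Nat.card G = (p - 1) * p := by
  classical
  have hle := Nat.le_of_dvd (irrDeg_pos h.mem) h.ncard_sub_one_dvd
  have hpn : p ≤ p ^ n := Nat.le_self_pow hn.ne' p
  rw [hN] at hle
  have hNp : (kerOthers θ).ncard = p := by omega
  have hd : irrDeg θ = p - 1 := by omega
  have h1 := h.sum_others_mul
  have h2 := sum_irrDeg_sq h.mem
  have hp2 := hp.two_le
  rw [hNp, hd, sq] at h1
  have h3 := Nat.eq_of_mul_eq_mul_right (by omega) h1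
  have hcard : Nat.card G = (p - 1) * p := by
    rw [← h2, h3, hd]
    obtain ⟨k, rfl⟩ : ∃ k, p = k + 1 := ⟨p - 1, by omega⟩
    rw [Nat.add_sub_cancel]
    ring
  refine ⟨hd, ?_, hcard⟩
  have hp3 : 2 < p := by
    rcases hp2.lt_or_eq with h4 | h4
    · exact h4
    · rw [hcard, ← h4] at hG
      omega
  obtain ⟨N, hNn, hNeq⟩ := exists_normal_eq_kerOthers θ
  have hNcard : Nat.card N = p := by
    rw [← hNp, ← hNeq]
    rfl
  have hmem : ∀ x, x ∈ N ↔ x ∈ kerOthers θ := fun x => by rw [← hNeq]; rfl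
  refine isDoublyTransitiveFrobenius_of_normal hp hp3 hNcard hcard fun c hc hc1 x hx => ?_
  have hc' := h.of_mem_kerOthers ((hmem c).1 hc) hc1
  refine mem_of_commute_of_forall_isConj hp hNcard hcard hc (fun y => ?_) hx
  constructor
  · intro hy
    refine ⟨(hmem y).2 (hc'.kerOthers_eq ▸ Or.inr hy), ?_⟩
    rintro rfl
    exact hc1 (isConj_one_left.1 hy)
  · exact fun hy => hc'.isConj_of_mem ((hmem y).1 hy.1) hy.2

/-- Used at `t = -c` for the Cauchy–Schwarz bound and at `t = 1` for its equality case. -/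
theorem sum_sq_mul_sub {ι : Type*} {s : Finset ι} {x y : ι → ℝ} {c p : ℝ}
    (hx : ∑ i ∈ s, x i ^ 2 = p - 1) (hxy : ∑ i ∈ s, x i * y i = -((p - 1) * c))
    (hy : ∑ i ∈ s, y i ^ 2 = p - c ^ 2) (t : ℝ) :
    ∑ i ∈ s, (t * x i - y i) ^ 2 = t ^ 2 * (p - 1) + 2 * t * ((p - 1) * c) + (p - c ^ 2) := by
  have h : ∀ i, (t * x i - y i) ^ 2 = t ^ 2 * x i ^ 2 - 2 * t * (x i * y i) + y i ^ 2 :=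
    fun i => by ring
  simp only [h, Finset.sum_add_distrib, Finset.sum_sub_distrib, ← Finset.mul_sum, hx, hxy, hy]
  ring

/-- The left side is the sum of `ψ` over `N`. It makes `ψ b` rational and gives a congruence modulo
`p`. -/
theorem irr_one_add_mul {N : Subgroup G} {p : ℕ} (hN : Nat.card N = p) {b : G}
    (hclass : ∀ c, IsConj b c ↔ c ∈ N ∧ c ≠ 1) {ψ : G → ℂ} (hψ : ψ ∈ IrrChars G) :
    ∃ m : ℕ, ψ 1 + (p - 1 : ℂ) * ψ b = p * m := by
  classical
  have := Fintype.ofFinite N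
  obtain ⟨m, hm⟩ := sum_subgroup_IrrChars hψ N
  refine ⟨m, ?_⟩
  rw [← hN, ← hm]
  have hsum : ∀ x : N, ψ x = (if x = 1 then ψ 1 - ψ b else 0) + ψ b := by
    intro x
    by_cases hx : x = 1
    · subst hx
      simp
    · rw [if_neg hx, zero_add]
      refine (IrrChars_eq_of_isConj hψ ((hclass x).2 ⟨x.2, fun h => hx ?_⟩)).symm
      exact OneMemClass.coe_eq_one.1 h
  rw [Finset.sum_congr rfl fun x _ => hsum x, Finset.sum_add_distrib]
  simp only [Finset.sum_ite_eq', Finset.mem_univ, if_true, Finset.sum_const, Finset.card_univ,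
    nsmul_eq_mul, Nat.card_eq_fintype_card]
  ring

theorem differsOnlyAt_of_class_eq {N : Subgroup G} {p : ℕ} (hp : p.Prime) (hp2 : 2 < p)
    (hG : Nat.card G = (p - 1) * p) (hN : Nat.card N = p) {b : G} (hb : b ∈ N) (hb1 : b ≠ 1)
    (hclass : ∀ c, IsConj b c ↔ c ∈ N ∧ c ≠ 1) {χ : G → ℂ} (hχ : χ ∈ IrrChars G)
    (hdeg : χ 1 = ((p - 1 : ℕ) : ℂ)) : DiffersOnlyAt χ b := by
  classical
  have hpR : (2 : ℝ) < p := by exact_mod_cast hp2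
  have hpcast : ((p - 1 : ℕ) : ℂ) = (p : ℂ) - 1 := by
    rw [Nat.cast_sub hp.one_le, Nat.cast_one]
  have hpC : (p : ℂ) - 1 ≠ 0 := by
    rw [← hpcast, Nat.cast_ne_zero]
    omega
  have hGC : (Nat.card G : ℂ) = ((p : ℂ) - 1) * p := by
    rw [hG, Nat.cast_mul, hpcast]
  choose! m hm using fun (ψ : G → ℂ) (hψ : ψ ∈ IrrChars G) => irr_one_add_mul hN hclass hψ
  let x : (G → ℂ) → ℝ := fun ψ => irrDeg ψ
  let y : (G → ℂ) → ℝ := fun ψ => (p * m ψ - irrDeg ψ) / (p - 1)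
  have hx : ∀ ψ ∈ IrrChars G, ψ 1 = (x ψ : ℂ) := fun ψ hψ => by
    rw [irr_one_eq hψ]
    simp [x]
  have hy : ∀ ψ ∈ IrrChars G, ψ b = (y ψ : ℂ) := fun ψ hψ => by
    have h1 := hm ψ hψ
    rw [irr_one_eq hψ] at h1
    simp only [y]
    push_cast
    rw [eq_div_iff hpC]
    linear_combination h1
  have hbinv : IsConj b b⁻¹ := (hclass _).2 ⟨N.inv_mem hb, inv_ne_one.2 hb1⟩
  have hclasscard : Nat.card {c // IsConj b c} = p - 1 := by
    have h1 : {c | IsConj b c} = (N : Set G) \ {1} := by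
      ext c
      simpa using hclass c
    change Set.ncard {c | IsConj b c} = _
    rw [h1, Set.ncard_sdiff_singleton_of_mem N.one_mem, ← hN]
    rfl
  have hχm := mem_irrFinset.2 hχ
  set c := y χ with hc
  have hxχ : x χ = p - 1 := by
    have := hx χ hχ
    rw [hdeg, hpcast] at this
    exact_mod_cast this.symm
  have sxx : ∑ ψ ∈ (irrFinset G).erase χ, x ψ ^ 2 = p - 1 := by
    have h1 := sum_irr_one_mul_one (G := G)
    rw [Finset.sum_congr rfl fun ψ hψ => by rw [hx ψ (mem_irrFinset.1 hψ)], hGC,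
      ← Finset.sum_erase_add _ _ hχm, hxχ] at h1
    have h2 : ∑ ψ ∈ (irrFinset G).erase χ, x ψ * x ψ + (p - 1) * (p - 1) = ((p : ℝ) - 1) * p := by
      exact_mod_cast h1
    simp only [← sq] at h2
    linarith
  have sxy : ∑ ψ ∈ (irrFinset G).erase χ, x ψ * y ψ = -((p - 1) * c) := by
    have h1 := sum_irr_eq_zero_of_not_isConj (a := b) (b := 1)
      fun h => hb1 (isConj_one_right.1 h)
    rw [inv_one, Finset.sum_congr rfl fun ψ hψ => by
      rw [hx ψ (mem_irrFinset.1 hψ), hy ψ (mem_irrFinset.1 hψ)],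
      ← Finset.sum_erase_add _ _ hχm, hxχ] at h1
    have h2 : ∑ ψ ∈ (irrFinset G).erase χ, x ψ * y ψ + (p - 1) * y χ = 0 := by
      exact_mod_cast h1
    linarith
  have syy : ∑ ψ ∈ (irrFinset G).erase χ, y ψ ^ 2 = p - c ^ 2 := by
    have h1 := sum_irr_self_mul_card (b := b)
    rw [hclasscard, hpcast, hGC, mul_comm] at h1
    replace h1 := mul_left_cancel₀ hpC h1
    rw [Finset.sum_congr rfl fun ψ hψ => by
      rw [← IrrChars_eq_of_isConj (mem_irrFinset.1 hψ) hbinv, hy ψ (mem_irrFinset.1 hψ)],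
      ← Finset.sum_erase_add _ _ hχm] at h1
    have h2 : ∑ ψ ∈ (irrFinset G).erase χ, y ψ * y ψ + y χ * y χ = p := by
      exact_mod_cast h1
    simp only [← sq] at h2
    linarith
  have hbound : c ^ 2 ≤ 1 := by
    -- At `t = -c` the sum of squares equals `p * (1 - c ^ 2)`.
    have h1 := sum_sq_mul_sub sxx sxy syy (-c)
    have h2 : 0 ≤ ∑ ψ ∈ (irrFinset G).erase χ, (-c * x ψ - y ψ) ^ 2 :=
      Finset.sum_nonneg fun _ _ => sq_nonneg _
    rw [h1] at h2
    by_contra! h3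
    nlinarith
  have hcm : c * (p - 1) = p * m χ - (p - 1) := by
    have h1 := hm χ hχ
    rw [hdeg, hpcast, hy χ hχ] at h1
    have h2 : ((p : ℝ) - 1) + (p - 1) * y χ = p * m χ := by exact_mod_cast h1
    linarith
  obtain ⟨z, hz⟩ := int_of_isIntegral_of_mul_eq (isIntegral_IrrChars hχ b)
    (k := (p : ℤ) - 1) (m := p * m χ - (p - 1)) (by omega) (by
      rw [hy χ hχ]
      push_cast
      exact_mod_cast hcm)
  have hcz : c = z := by
    rw [hy χ hχ] at hz
    exact_mod_cast hz
  rw [hcz] at hcm hbound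
  have hz2 : z ^ 2 ≤ 1 := by exact_mod_cast hbound
  have hzm : (z + 1) * ((p : ℤ) - 1) = p * m χ := by
    have : (z : ℤ) * (p - 1) = p * m χ - (p - 1) := by exact_mod_cast hcm
    linarith
  have hdvd : (p : ℤ) ∣ z + 1 := by
    have h1 : (p : ℤ) ∣ (z + 1) * p - (z + 1) * ((p : ℤ) - 1) :=
      dvd_sub (Dvd.intro_left _ rfl) (hzm ▸ Dvd.intro _ rfl)
    have h2 : (z + 1) * (p : ℤ) - (z + 1) * ((p : ℤ) - 1) = z + 1 := by ring
    rwa [h2] at h1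
  -- Here `0 ≤ z + 1 ≤ 2 < p`, so divisibility by `p` leaves only `z + 1 = 0`.
  have hz1 : z = -1 := by
    have h1 : z ≤ 1 := by nlinarith
    have h2 : -1 ≤ z := by nlinarith
    by_contra hne
    have := Int.le_of_dvd (by omega) hdvd
    omega
  have hc1 : c = -1 := by rw [hcz, hz1]; simp
  refine ⟨hχ, fun ψ hψ hne => ?_, ?_⟩
  · have h1 := sum_sq_mul_sub sxx sxy syy 1
    rw [hc1] at h1
    have h2 : ∑ ψ ∈ (irrFinset G).erase χ, (1 * x ψ - y ψ) ^ 2 = 0 := by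
      rw [h1]
      ring
    have h3 := (Finset.sum_eq_zero_iff_of_nonneg fun _ _ => sq_nonneg _).1 h2 ψ
      (Finset.mem_erase.2 ⟨hne, mem_irrFinset.2 hψ⟩)
    have h4 := pow_eq_zero_iff (two_ne_zero) |>.1 h3
    rw [hx ψ hψ, hy ψ hψ]
    congr 1
    linarith
  · rw [hx χ hχ, hy χ hχ, ← hc, hc1, hxχ]
    intro h1
    have h2 : (-1 : ℝ) = p - 1 := by exact_mod_cast h1
    linarith

omit [Fintype G] in
theorem DiffersOnlyAt.isCD1Group {θ : G → ℂ} {b : G} (h : DiffersOnlyAt θ b)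
    (hG : 2 < Nat.card G) : IsCD1Group G := by
  refine ⟨hG, b, 1, θ, ⟨h.mem, h.differ⟩, fun ψ hψ => ?_⟩
  by_contra hne
  exact hψ.2 (h.agree ψ hψ.1 hne)

end MainTheorem

theorem corollary3p4 {G : Type*} [Group G] [Finite G] (χ : G → ℂ) (a : ℕ)
    (hχ : χ ∈ IrrChars G) (hχa : χ 1 = (a : ℂ)) (ha : IsGreatest (irrDegrees G) a) :
    (IsCD1Group G → ∃ p n : ℕ, p.Prime ∧ 0 < n ∧ (kerOthers χ).ncard = p ^ n) ∧
    ∀ p : ℕ, p.Prime →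
      ((IsCD1Group G ∧ (∃ n : ℕ, 0 < n ∧ (kerOthers χ).ncard = p ^ n) ∧ a < p) ↔
        (a = p - 1 ∧ IsDoublyTransitiveFrobenius G ∧ Nat.card G = (p - 1) * p)) := by
  have := Fintype.ofFinite G
  have hdiff : IsCD1Group G → ∃ b, DiffersOnlyAt χ b := by
    intro hG
    obtain ⟨θ, b, h⟩ := hG.exists_differsOnlyAt
    rw [h.eq_of_isGreatest hG.1 hχ hχa ha]
    exact ⟨b, h⟩
  refine ⟨fun hG => ?_, fun p hp => ⟨?_, ?_⟩⟩
  · obtain ⟨b, h⟩ := hdiff hG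
    exact h.exists_prime_pow
  · rintro ⟨hG, ⟨n, hn, hN⟩, hap⟩
    obtain ⟨b, h⟩ := hdiff hG
    rw [← irrDeg_eq hχa] at hap ⊢
    exact h.isDoublyTransitiveFrobenius hG.1 hp hn hN hap
  · rintro ⟨rfl, hF, hcard⟩
    obtain ⟨hp2, N, hN, hclass⟩ := hF.exists_normal hp hcard
    have : Nontrivial N := by
      have : Fintype N := Fintype.ofFinite N
      rw [← Fintype.one_lt_card_iff_nontrivial, ← Nat.card_eq_fintype_card, hN]
      exact hp.one_lt
    obtain ⟨⟨b, hb⟩, hb1⟩ := exists_ne (1 : N)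
    have hb1' : b ≠ 1 := fun h1 => hb1 (Subtype.ext h1)
    have h := differsOnlyAt_of_class_eq hp hp2 hcard hN hb hb1' (hclass b hb hb1') hχ hχa
    have hG2 : 2 < Nat.card G := by
      have : 1 * p ≤ (p - 1) * p := Nat.mul_le_mul_right p (by omega)
      omega
    refine ⟨h.isCD1Group hG2, ⟨1, one_pos, ?_⟩, by omega⟩
    have hker : kerOthers χ = N := by
      rw [h.kerOthers_eq]
      ext c
      simp only [Set.mem_insert_iff, Set.mem_ofPred_eq, hclass b hb hb1' c, SetLike.mem_coe]
      constructor
      · rintro (rfl | h1)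
        · exact N.one_mem
        · exact h1.1
      · intro h1
        by_cases hc : c = 1
        · exact Or.inl hc
        · exact Or.inr ⟨h1, hc⟩
    rw [hker, pow_one]
    exact hN
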